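/- Let $\mathbf{a}$ be a Turing degree that contains a computably enumerable (c.e.) set and is not low, i.e. $\mathbf{a}' \neq \mathbf{0}'$, where $'$ denotes the Turing jump. Then $\mathbf{a}$ contains a c.e. set $A \subseteq \mathbb{N}$ of asymptotic density $\frac12$, i.e. $$\lim_{n \to \infty} \frac{|A \cap \{0, 1, \dots, n-1\}|}{n} = \frac12,$$ such that $A$ is not coarsely computable: there is no computable set $C \subseteq \mathbb{N}$ such that $\{n \in \mathbb{N} : n \in A \Leftrightarrow n \in C\}$ has asymptotic density $1$. -/

import Mathlib

open Filter Topology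

/-- The characteristic function of a set of natural numbers, as a (total) oracle. -/
noncomputable def charFun (X : Set ℕ) : ℕ →. ℕ :=
  fun n => Part.some (X.indicator 1 n)

/-- The Turing degree of a set of natural numbers. -/
noncomputable def turingDegreeOf (X : Set ℕ) : TuringDegree :=
  toAntisymmetrization TuringReducible (charFun X)

/-- Computably enumerable sets of natural numbers. -/
def IsCESet (X : Set ℕ) : Prop := REPred fun n => n ∈ X

/-- Computable sets of natural numbers. -/
def IsComputableSet (X : Set ℕ) : Prop := ComputablePred fun n => n ∈ X

open Classical in
/-- The initial segment of (the characteristic function of) `X` of length `k`. -/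
noncomputable def initialSegment (X : Set ℕ) (k : ℕ) : List Bool :=
  (List.range k).map fun j => decide (j ∈ X)

/-- The `e`-th set `W_e^X` that is computably enumerable in `X`, i.e. the domain of the `e`-th
Turing functional with oracle `X`. A Turing functional is presented, as usual, by the c.e. set of
pairs `(n, σ)` such that the computation with input `n` halts when its oracle queries are answered
by the finite string `σ`; here this c.e. set is the domain of the `e`-th partial computable
function. Then `n ∈ W_e^X` iff the computation halts with some initial segment of `X` as oracle. -/
def oracleCESet (X : Set ℕ) (e : ℕ) : Set ℕ :=
  {n | ∃ k : ℕ, ((Denumerable.ofNat Nat.Partrec.Code e).eval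
    (Encodable.encode (n, initialSegment X k))).Dom}

/-- The Turing jump `X' = {e | e ∈ W_e^X}`. -/
def turingJump (X : Set ℕ) : Set ℕ := {e | e ∈ oracleCESet X e}

/-- A set is low if its jump is Turing equivalent to the jump of the empty set. -/
def IsLowSet (X : Set ℕ) : Prop :=
  turingDegreeOf (turingJump X) = turingDegreeOf (turingJump ∅)

/-- A Turing degree is c.e. if it contains a c.e. set. -/
def IsCEDegree (a : TuringDegree) : Prop :=
  ∃ X : Set ℕ, turingDegreeOf X = a ∧ IsCESet X

/-- A Turing degree is low if it contains a low set. (The degree of the jump of a set depends only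
on the degree of the set, so that then every set in the degree is low.) -/
def IsLowDegree (a : TuringDegree) : Prop :=
  ∃ X : Set ℕ, turingDegreeOf X = a ∧ IsLowSet X

/-- The set `A` has asymptotic density `r`: `|A ∩ {0, …, n - 1}| / n` tends to `r`. -/
def HasAsymptoticDensity (A : Set ℕ) (r : ℝ) : Prop :=
  Tendsto (fun n : ℕ => ((A ∩ Set.Iio n).ncard : ℝ) / n) atTop (𝓝 r)

/-- `A` is coarsely computable if some computable set `C` agrees with `A` on a set of asymptotic
density `1`. -/
def IsCoarselyComputable (A : Set ℕ) : Prop :=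
  ∃ C : Set ℕ, IsComputableSet C ∧ HasAsymptoticDensity {n | n ∈ A ↔ n ∈ C} 1

/-! Fix a stage enumeration of a nonlow c.e. set `C` in the degree. The set `A` (`releaseSet`) is
built on the pairs `{2k, 2k+1}`: it takes exactly one element of the pair if `k` is ever released,
none otherwise. The release of `k` waits for some element of a finite list to enter `C`, so `A` is
computable from `C`. The numbers `k = 2^j` wait for `j` itself, which codes `C` into `A`.

For any other `k ≠ 0`, the exponent of `2` in `k` codes a program `e` and an index `i`, and its
binary logarithm is a stage `s`. If a new computation `i ∈ W_i^C` appears at stage `s`, then `k`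
waits for `C` to destroy it; otherwise `k` is released at once. Upon release, the side is chosen
against the value of program `e` at `2k`, if that is known.

Density: for each `i` only finitely many computations appear anew and are never destroyed
(`exists_restraint_violated`), so the unreleased numbers with a given exponent are finite in number,
and the unreleased pairs have density `0`.

Noncomputability: let `e` compute `D`, with halting times bounded by `h`. If for every `i` almost
all new computations that survive to stage `h s` were permanent, then `C'` would have a computable
approximation and `C` would be low (`exists_frequently_restraint_violated_late`). So some `i` has
infinitely many `s` whose release comes after stage `h s`, when `e` has answered. At each of them
`A` and `D` differ on a whole block, a fixed fraction of an initial segment. -/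

open Encodable Denumerable
open Nat.Partrec (Code)

/-! ### Relative computability by searches of finite use -/

namespace Nat.RecursiveIn

variable {O : Set (ℕ →. ℕ)} {f g : ℕ → ℕ}

theorem comp_total (hf : Nat.RecursiveIn O fun n => Part.some (f n))
    (hg : Nat.RecursiveIn O fun n => Part.some (g n)) :
    Nat.RecursiveIn O fun n => Part.some (f (g n)) :=
  (Nat.RecursiveIn.comp hf hg).of_eq fun n => by simp

theorem pair_total (hf : Nat.RecursiveIn O fun n => Part.some (f n))
    (hg : Nat.RecursiveIn O fun n => Part.some (g n)) :
    Nat.RecursiveIn O fun n => Part.some (Nat.pair (f n) (g n)) :=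
  (Nat.RecursiveIn.pair hf hg).of_eq fun n => by simp [Seq.seq]

theorem of_computable (hf : Computable f) : Nat.RecursiveIn O fun n => Part.some (f n) :=
  (Partrec.nat_iff.1 hf.partrec).recursiveIn

end Nat.RecursiveIn

open Classical in
theorem initialSegment_succ (X : Set ℕ) (k : ℕ) :
    initialSegment X (k + 1) = initialSegment X k ++ [decide (k ∈ X)] := by
  simp [initialSegment, List.range_succ]

@[simp] theorem length_initialSegment (X : Set ℕ) (k : ℕ) :
    (initialSegment X k).length = k := by
  simp [initialSegment]

open Classical in
theorem getElem?_initialSegment (X : Set ℕ) (k n : ℕ) :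
    (initialSegment X k)[n]? = if n < k then some (decide (n ∈ X)) else none := by
  split_ifs with h
  · simp [initialSegment, h]
  · simpa [initialSegment] using h

theorem getElem?_initialSegment_eq_false {X : Set ℕ} {k n : ℕ} :
    (initialSegment X k)[n]? = some false ↔ n < k ∧ n ∉ X := by
  classical
  rw [getElem?_initialSegment]
  split_ifs with h <;> simp [h]

theorem initialSegment_recursiveIn (X : Set ℕ) :
    Nat.RecursiveIn {charFun X} fun k => Part.some (encode (initialSegment X k)) := by
  classical
  have horacle : Nat.RecursiveIn {charFun X} fun n => Part.some (X.indicator 1 n) :=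
    Nat.RecursiveIn.oracle _ rfl
  have hfst : Computable fun n : ℕ => n.unpair.1 := Computable.fst.comp Computable.unpair
  have hsnd : Computable fun n : ℕ => n.unpair.2 := Computable.snd.comp Computable.unpair
  -- `q` pairs the code of the string built so far with the next oracle bit.
  let step : ℕ → ℕ := fun q =>
    encode (((decode (α := List Bool) q.unpair.1).getD []) ++ [q.unpair.2 == 1])
  have hstep : Computable step := by
    refine Computable.encode.comp (Computable.list_append.comp ?_ ?_)
    · exact Computable.option_getD (Computable.decode.comp hfst) (Computable.const [])
    · exact Computable.list_cons.comp
        (Primrec.beq.to_comp.comp hsnd (Computable.const 1)) (Computable.const [])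
  have hh : Nat.RecursiveIn {charFun X} fun p => Part.some
      (step (Nat.pair p.unpair.2.unpair.2 (X.indicator 1 p.unpair.2.unpair.1))) :=
    (Nat.RecursiveIn.of_computable hstep).comp_total
      ((Nat.RecursiveIn.of_computable (hsnd.comp hsnd)).pair_total
        (horacle.comp_total (Nat.RecursiveIn.of_computable (hfst.comp hsnd))))
  have hrec := Nat.RecursiveIn.prec
    (Nat.RecursiveIn.of_computable (O := {charFun X})
      (Computable.const (encode ([] : List Bool)))) hh
  have hin : Nat.RecursiveIn {charFun X} fun n => Part.some (Nat.pair 0 n) :=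
    Nat.RecursiveIn.of_computable
      (Primrec₂.natPair.to_comp.comp (Computable.const 0) Computable.id)
  refine (Nat.RecursiveIn.comp hrec hin).of_eq fun n => ?_
  simp only [Part.bind_eq_bind, Part.bind_some, Nat.unpair_pair]
  induction n with
  | zero => simp [initialSegment]
  | succ n ih =>
    simp only at ih ⊢
    refine (congrArg (fun p : Part ℕ => p.bind _) ih).trans ?_
    by_cases hn : n ∈ X <;> simp [hn, step, initialSegment_succ]

/-- A function is recursive in `X` as soon as its values can be found by a search that inspects
finite initial segments of `X`. -/
theorem turingReducible_of_finite_use {X : Set ℕ} {f : ℕ → ℕ}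
    {v : ℕ → ℕ → List Bool → Option ℕ}
    (hv : Computable fun p : (ℕ × ℕ) × List Bool => v p.1.1 p.1.2 p.2)
    (total : ∀ n, ∃ m, (v n m (initialSegment X m)).isSome)
    (sound : ∀ n m y, v n m (initialSegment X m) = some y → y = f n) :
    TuringReducible (fun n => Part.some (f n)) (charFun X) := by
  refine RecursiveIn.iff_nat.2 ?_
  have hfst : Computable fun n : ℕ => n.unpair.1 := Computable.fst.comp Computable.unpair
  have hsnd : Computable fun n : ℕ => n.unpair.2 := Computable.snd.comp Computable.unpair
  let w : ℕ → Option ℕ := fun q =>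
    v q.unpair.1.unpair.1 q.unpair.1.unpair.2 ((decode (α := List Bool) q.unpair.2).getD [])
  have hw : Computable w := hv.comp
    (((hfst.comp hfst).pair (hsnd.comp hfst)).pair
      (Computable.option_getD (Computable.decode.comp hsnd) (Computable.const [])))
  let u : ℕ → ℕ := fun p => Nat.pair p (encode (initialSegment X p.unpair.2))
  have hu : Nat.RecursiveIn {charFun X} fun p => Part.some (u p) :=
    (Nat.RecursiveIn.of_computable Computable.id).pair_total
      ((initialSegment_recursiveIn X).comp_total (Nat.RecursiveIn.of_computable hsnd))
  have hwu : ∀ n m, w (u (Nat.pair n m)) = v n m (initialSegment X m) := fun n m => by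
    simp [w, u]
  have htest : Computable fun q => bif (w q).isSome then 0 else 1 :=
    Computable.cond (Primrec.option_isSome.to_comp.comp hw) (Computable.const 0)
      (Computable.const 1)
  have hvalue : Computable fun q => (w q).getD 0 :=
    Computable.option_getD hw (Computable.const 0)
  have hfind := Nat.RecursiveIn.rfind ((Nat.RecursiveIn.of_computable htest).comp_total hu)
  have hpair := Nat.RecursiveIn.pair
    (Nat.RecursiveIn.of_computable (O := {charFun X}) Computable.id) hfind
  refine (Nat.RecursiveIn.comp ((Nat.RecursiveIn.of_computable hvalue).comp_total hu)
    hpair).of_eq fun n => ?_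
  obtain ⟨m, hm⟩ : ∃ m, m ∈ Nat.rfind fun m =>
      (fun k => decide (k = 0)) <$> Part.some (bif (w (u (Nat.pair n m))).isSome then 0 else 1) := by
    obtain ⟨m, hm⟩ := total n
    refine Part.dom_iff_mem.1 (Nat.rfind_dom.2 ?_)
    exact ⟨m, by simp [hwu, hm], fun _ => by simp⟩
  have hsome := Nat.rfind_spec hm
  rw [Part.eq_some_iff.2 hm]
  rw [hwu] at hsome
  cases hy : v n m (initialSegment X m) with
  | none => simp [hy] at hsome
  | some y => simp [Seq.seq, hwu, hy, sound n m y hy]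

theorem charFun_reducible_of_manyOne {X Y : Set ℕ} {r : ℕ → ℕ} (hr : Computable r)
    (h : ∀ n, n ∈ X ↔ r n ∈ Y) : TuringReducible (charFun X) (charFun Y) := by
  classical
  refine turingReducible_of_finite_use
    (v := fun n _ σ => σ[r n]?.map fun b => bif b then 1 else 0) ?_ ?_ ?_
  · refine Computable.option_map (Computable.list_getElem?.comp Computable.snd
      (hr.comp (Computable.fst.comp Computable.fst))) ?_
    exact (Computable.cond Computable.snd (Computable.const 1) (Computable.const 0)).to₂
  · exact fun n => ⟨r n + 1, by simp⟩
  · intro n m y hy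
    rw [getElem?_initialSegment] at hy
    by_cases hlt : r n < m
    swap
    · simp [hlt] at hy
    rw [if_pos hlt] at hy
    by_cases hn : n ∈ X
    · simpa [hn, (h n).1 hn, eq_comm] using hy
    · simpa [hn, mt (h n).2 hn, eq_comm] using hy

/-! ### The jump and the limit lemma -/

/-- Every c.e. set is many-one reducible to the jump of every set. -/
theorem exists_manyOne_turingJump (X : Set ℕ) {W : Set ℕ} (hW : IsCESet W) :
    ∃ r : ℕ → ℕ, Computable r ∧ ∀ n, n ∈ W ↔ r n ∈ turingJump X := by
  have hf : Partrec fun p : ℕ => (Part.assert (p.unpair.1 ∈ W) fun _ => Part.some ()).map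
      fun _ => 0 :=
    ((show Partrec _ from hW).comp (Computable.fst.comp Computable.unpair)).map
      (Computable.const 0).to₂
  obtain ⟨code, hcode⟩ := Code.exists_code.1 (Partrec.nat_iff.1 hf)
  refine ⟨fun n => encode (code.curry n), ?_, fun n => ?_⟩
  · exact Computable.encode.comp
      (Code.primrec₂_curry.to_comp.comp (Computable.const code) Computable.id)
  · simp [turingJump, oracleCESet, Code.eval_curry, hcode, Part.assert]

/-- The initial segments of `∅` are computable strings of `false`, so `∅'` is c.e. and every jump
computes it. -/
theorem turingJump_empty_reducible (X : Set ℕ) :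
    TuringReducible (charFun (turingJump ∅)) (charFun (turingJump X)) := by
  suffices h : IsCESet (turingJump ∅) by
    obtain ⟨r, hr, hiff⟩ := exists_manyOne_turingJump X h
    exact charFun_reducible_of_manyOne hr hiff
  have hseg : ∀ k, initialSegment ∅ k = (List.range k).map fun _ => false := fun k => by
    simp [initialSegment]
  have hlist : Primrec fun k : ℕ => (List.range k).map fun _ => false :=
    Primrec.list_map Primrec.list_range (Primrec.const false).to₂
  have hσ : Primrec fun q : ℕ × ℕ => (List.range q.2.unpair.2).map fun _ => false :=
    hlist.comp (Primrec.snd.comp (Primrec.unpair.comp Primrec.snd))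
  have hin : Primrec fun q : ℕ × ℕ =>
      encode (q.1, (List.range q.2.unpair.2).map fun _ => false) :=
    Primrec.encode.comp (Primrec.pair Primrec.fst hσ)
  have hstep : Computable₂ fun (e : ℕ) (p : ℕ) =>
      (Code.evaln p.unpair.1 (ofNat Code e)
        (encode (e, (List.range p.unpair.2).map fun _ => false))) := by
    have hs : Primrec fun q : ℕ × ℕ => q.2.unpair.1 :=
      Primrec.fst.comp (Primrec.unpair.comp Primrec.snd)
    have he : Primrec fun q : ℕ × ℕ => ofNat Code q.1 :=
      (Primrec.ofNat _).comp Primrec.fst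
    exact Primrec.to_comp (Code.primrec_evaln.comp ((hs.pair he).pair hin))
  refine (Partrec.rfindOpt hstep).dom_re.of_eq fun e => ?_
  rw [Nat.rfindOpt_dom]
  simp only [turingJump, oracleCESet, Set.mem_ofPred_eq, hseg,
    Part.dom_iff_mem, Code.evaln_complete]
  constructor
  · rintro ⟨p, y, hy⟩
    exact ⟨p.unpair.2, y, p.unpair.1, hy⟩
  · rintro ⟨k, y, s, hy⟩
    exact ⟨Nat.pair s k, y, by simpa using hy⟩

/-- The limit lemma: a set with a computable approximation is recursive in the halting problem. -/
theorem charFun_reducible_turingJump_empty {B : Set ℕ} {g : ℕ → ℕ → Bool} (hg : Computable₂ g)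
    (hlim : ∀ n, ∃ b, ∀ s ≥ b, (g n s = true ↔ n ∈ B)) :
    TuringReducible (charFun B) (charFun (turingJump ∅)) := by
  classical
  -- `W` holds the pairs `(n, s)` for which the approximation at `n` takes another value after stage
  -- `s`. It is c.e., so `∅'` can recognize a stage whose value is final.
  let W : Set ℕ := {p | ∃ t, p.unpair.2 ≤ t ∧ g p.unpair.1 t ≠ g p.unpair.1 p.unpair.2}
  have hfst : Computable fun n : ℕ => n.unpair.1 := Computable.fst.comp Computable.unpair
  have hsnd : Computable fun n : ℕ => n.unpair.2 := Computable.snd.comp Computable.unpair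
  have hW : IsCESet W := by
    have htest : Computable₂ fun (p : ℕ) (t : ℕ) =>
        decide (p.unpair.2 ≤ t) && (g p.unpair.1 t ^^ g p.unpair.1 p.unpair.2) := by
      refine Primrec.and.to_comp.comp ?_ ((Primrec.dom_bool₂ xor).to_comp.comp ?_ ?_)
      · exact Primrec.nat_le.decide.to_comp.comp (hsnd.comp Computable.fst) Computable.snd
      · exact hg.comp (hfst.comp Computable.fst) Computable.snd
      · exact hg.comp (hfst.comp Computable.fst) (hsnd.comp Computable.fst)
    refine (Partrec.rfind htest.partrec₂).dom_re.of_eq fun p => ?_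
    rw [Nat.rfind_dom]
    simp [W]
  obtain ⟨r, hr, hrW⟩ := exists_manyOne_turingJump ∅ hW
  refine turingReducible_of_finite_use
    (v := fun n m σ => bif σ[r (Nat.pair n m.unpair.1)]? == some false then
      some (bif g n m.unpair.1 then 1 else 0) else none) ?_ ?_ ?_
  · have hn : Computable fun p : (ℕ × ℕ) × List Bool => p.1.1 :=
      Computable.fst.comp Computable.fst
    have hm : Computable fun p : (ℕ × ℕ) × List Bool => p.1.2.unpair.1 :=
      hfst.comp (Computable.snd.comp Computable.fst)
    have hbit : Computable fun p : (ℕ × ℕ) × List Bool =>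
        p.2[r (Nat.pair p.1.1 p.1.2.unpair.1)]? :=
      Computable.list_getElem?.comp Computable.snd
        (hr.comp (Primrec₂.natPair.to_comp.comp hn hm))
    have hout : Computable fun p : (ℕ × ℕ) × List Bool =>
        some (bif g p.1.1 p.1.2.unpair.1 then 1 else 0) :=
      Computable.option_some.comp
        (Computable.cond (hg.comp hn hm) (Computable.const 1) (Computable.const 0))
    have htest : Computable fun o : Option Bool => o == some false :=
      (Primrec.dom_finite _).to_comp
    exact Computable.cond (htest.comp hbit) hout (Computable.const none)
  · intro n
    obtain ⟨b, hb⟩ := hlim n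
    -- The first component is the stage to test; the second only makes the oracle string long enough
    -- for the query.
    refine ⟨Nat.pair b (r (Nat.pair n b) + 1), ?_⟩
    have h1 : r (Nat.pair n b) ∉ turingJump ∅ := by
      rw [← hrW]
      rintro ⟨t, ht, hne⟩
      simp only [Nat.unpair_pair] at ht hne
      exact hne (Bool.eq_iff_iff.2 ((hb t ht).trans (hb b le_rfl).symm))
    have h2 : r (Nat.pair n b) < Nat.pair b (r (Nat.pair n b) + 1) :=
      Nat.lt_of_succ_le (Nat.right_le_pair _ _)
    simp [getElem?_initialSegment_eq_false.2 ⟨h2, h1⟩]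
  · intro n m y hy
    obtain ⟨b, hb⟩ := hlim n
    cases hσ : (initialSegment (turingJump ∅) m)[r (Nat.pair n m.unpair.1)]? == some false with
    | false => simp [hσ] at hy
    | true =>
      have h1 := (getElem?_initialSegment_eq_false.1 (beq_iff_eq.1 hσ)).2
      rw [← hrW] at h1
      simp only [W, Set.mem_ofPred_eq, Nat.unpair_pair, not_exists, not_and, not_not] at h1
      have h2 := h1 (max b m.unpair.1) (le_max_right _ _)
      have h3 := hb (max b m.unpair.1) (le_max_left _ _)
      rw [h2] at h3
      by_cases hn : n ∈ B
      · simpa [hσ, h3.2 hn, hn, eq_comm] using hy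
      · have : g n m.unpair.1 = false := by simpa using mt h3.1 hn
        simpa [hσ, this, hn, eq_comm] using hy

theorem turingDegreeOf_eq_iff {X Y : Set ℕ} : turingDegreeOf X = turingDegreeOf Y ↔
    TuringReducible (charFun X) (charFun Y) ∧ TuringReducible (charFun Y) (charFun X) :=
  Quotient.eq

/-- The limit lemma gives `X' ≤ ∅'`; the converse reduction always holds. -/
theorem isLowSet_of_limit {X : Set ℕ} {g : ℕ → ℕ → Bool} (hg : Computable₂ g)
    (hlim : ∀ n, ∃ b, ∀ s ≥ b, (g n s = true ↔ n ∈ turingJump X)) : IsLowSet X :=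
  turingDegreeOf_eq_iff.2
    ⟨charFun_reducible_turingJump_empty hg hlim, turingJump_empty_reducible X⟩

/-! ### Quantifiers over lists, and enumerations in stages -/

theorem Primrec.list_any {α β : Type*} [Primcodable α] [Primcodable β] {f : α → List β}
    {p : α → β → Bool} (hf : Primrec f) (hp : Primrec₂ p) :
    Primrec fun a => (f a).any (p a) :=
  (Primrec.nat_lt.decide.comp (Primrec.list_findIdx hf hp) (Primrec.list_length.comp hf)).of_eq
    fun a => by
      rw [Bool.eq_iff_iff, decide_eq_true_iff, List.findIdx_lt_length, List.any_eq_true]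

theorem Primrec.list_all {α β : Type*} [Primcodable α] [Primcodable β] {f : α → List β}
    {p : α → β → Bool} (hf : Primrec f) (hp : Primrec₂ p) :
    Primrec fun a => (f a).all (p a) :=
  (Primrec.not.comp (Primrec.list_any hf (Primrec.not.comp₂ hp))).of_eq
    fun a => by rw [List.not_any_eq_all_not]; simp

/-- An effective enumeration of `C` in stages. -/
structure StageEnumeration (C : Set ℕ) where
  /-- `stage s n` tells whether `n` has been enumerated by stage `s`. -/
  stage : ℕ → ℕ → Bool
  primrec : Primrec₂ stage
  mono : ∀ {s t n}, s ≤ t → stage s n = true → stage t n = true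
  mem_iff : ∀ {n}, n ∈ C ↔ ∃ s, stage s n = true

theorem IsCESet.exists_stageEnumeration {C : Set ℕ} (hC : IsCESet C) :
    Nonempty (StageEnumeration C) := by
  obtain ⟨code, hcode⟩ := Code.exists_code.1
    (Partrec.nat_iff.1 ((show Partrec _ from hC).map (Computable.const 0).to₂))
  refine ⟨⟨fun s n => (code.evaln s n).isSome, ?_, fun hst h => ?_, fun {n} => ?_⟩⟩
  · exact Primrec.option_isSome.comp (Code.primrec_evaln.comp
      ((Primrec.fst.pair (Primrec.const code)).pair Primrec.snd))
  · obtain ⟨y, hy⟩ := Option.isSome_iff_exists.1 h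
    exact Option.isSome_iff_exists.2 ⟨y, Code.evaln_mono hst hy⟩
  · have h : n ∈ C ↔ (code.eval n).Dom := by simp [hcode, Part.assert]
    rw [h, Part.dom_iff_mem]
    simp only [Code.evaln_complete, Option.isSome_iff_exists, Option.mem_def]
    exact exists_comm

/-! ### Sets of released numbers -/

namespace StageEnumeration

variable {C : Set ℕ} (E : StageEnumeration C) (L : ℕ → Option (List ℕ)) (V : ℕ → ℕ → Bool)

/-- The number `k` is released when an element of the list `L k` enters `C`; it is released at
once if there is no such list. -/
def released (k t : ℕ) : Bool := (L k).elim true fun l => l.any (E.stage t)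

/-- The set containing, for each released `k`, one of `2 * k` and `2 * k + 1`; which one is
decided by the value of `V` at the stage of the release. -/
def releaseSet : Set ℕ :=
  {x | ∃ t, E.released L (x / 2) t = true ∧ (∀ t' < t, E.released L (x / 2) t' = false) ∧
    V (x / 2) t = (x % 2 == 0)}

variable {L V}

theorem released_iff {k t : ℕ} :
    E.released L k t = true ↔ ∀ l, L k = some l → ∃ x ∈ l, E.stage t x = true := by
  cases h : L k <;> simp [released, h]

theorem released_mono {k s t : ℕ} (hst : s ≤ t) (h : E.released L k s = true) :
    E.released L k t = true := by
  rw [released_iff] at h ⊢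
  intro l hl
  obtain ⟨x, hx, hs⟩ := h l hl
  exact ⟨x, hx, E.mono hst hs⟩

theorem exists_released_iff {k : ℕ} :
    (∃ t, E.released L k t = true) ↔ ∀ l, L k = some l → ∃ x ∈ l, x ∈ C := by
  constructor
  · rintro ⟨t, ht⟩ l hl
    obtain ⟨x, hx, hs⟩ := E.released_iff.1 ht l hl
    exact ⟨x, hx, E.mem_iff.2 ⟨t, hs⟩⟩
  · intro h
    cases hk : L k with
    | none => exact ⟨0, by simp [released, hk]⟩
    | some l =>
      obtain ⟨x, hx, hxC⟩ := h l hk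
      obtain ⟨t, ht⟩ := E.mem_iff.1 hxC
      exact ⟨t, E.released_iff.2 fun l' hl' => by
        rw [hk, Option.some_inj] at hl'
        exact ⟨x, hl' ▸ hx, ht⟩⟩

/-- A released number has a first stage of release. -/
theorem exists_first_released {k : ℕ} (h : ∃ t, E.released L k t = true) :
    ∃ t, E.released L k t = true ∧ ∀ t' < t, E.released L k t' = false := by
  classical
  exact ⟨Nat.find h, Nat.find_spec h, fun t' ht' => by simpa using Nat.find_min h ht'⟩

theorem mem_releaseSet_iff {x t : ℕ} (ht : E.released L (x / 2) t = true)
    (hmin : ∀ t' < t, E.released L (x / 2) t' = false) :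
    x ∈ E.releaseSet L V ↔ V (x / 2) t = (x % 2 == 0) := by
  refine ⟨?_, fun h => ⟨t, ht, hmin, h⟩⟩
  rintro ⟨t', ht', hmin', h⟩
  have : t = t' := by
    rcases lt_trichotomy t t' with hlt | rfl | hlt
    · simp [hmin' t hlt] at ht
    · rfl
    · simp [hmin t' hlt] at ht'
  rwa [this]

theorem not_mem_releaseSet {x : ℕ} (h : ¬ ∃ t, E.released L (x / 2) t = true) :
    x ∉ E.releaseSet L V := by
  rintro ⟨t, ht, -⟩
  exact h ⟨t, ht⟩

theorem primrec_released (hL : Primrec L) : Primrec₂ (E.released L) := by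
  have hany : Primrec₂ fun (p : ℕ × ℕ) (l : List ℕ) => l.any (E.stage p.2) :=
    Primrec.list_any Primrec.snd
      (E.primrec.comp (Primrec.snd.comp (Primrec.fst.comp Primrec.fst)) Primrec.snd).to₂
  exact (Primrec.option_casesOn (hL.comp Primrec.fst) (Primrec.const true) hany).of_eq
    fun p => by cases h : L p.1 <;> simp [released, h]

theorem isCESet_releaseSet (hL : Primrec L) (hV : Primrec₂ V) :
    IsCESet (E.releaseSet L V) := by
  have hhalf : Primrec fun x : ℕ => x / 2 := Primrec.nat_div.comp Primrec.id (Primrec.const 2)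
  have hpar : Primrec fun x : ℕ => x % 2 == 0 :=
    Primrec.beq.comp (Primrec.nat_mod.comp Primrec.id (Primrec.const 2)) (Primrec.const 0)
  have hfind : Partrec fun x => Nat.rfind fun t => Part.some (E.released L (x / 2) t) :=
    Partrec.rfind (Computable₂.partrec₂ ((E.primrec_released hL).to_comp.comp
      (hhalf.to_comp.comp Computable.fst) Computable.snd))
  have htest : Primrec fun q : ℕ × ℕ => V (q.1 / 2) q.2 == (q.1 % 2 == 0) :=
    Primrec.beq.comp (hV.comp (hhalf.comp Primrec.fst) Primrec.snd) (hpar.comp Primrec.fst)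
  have hcheck : Partrec₂ fun (x t : ℕ) =>
      bif V (x / 2) t == (x % 2 == 0) then Part.some () else Part.none :=
    Partrec.cond htest.to_comp (Computable.const ()).partrec Partrec.none
  refine (hfind.bind hcheck).dom_re.of_eq fun x => ?_
  simp only [Part.bind_dom, releaseSet, Set.mem_ofPred_eq]
  constructor
  · rintro ⟨h1, h2⟩
    have hm := Nat.mem_rfind.1 (Part.get_mem h1)
    refine ⟨_, by simpa using hm.1, fun t' ht' => by simpa using hm.2 ht', ?_⟩
    cases hv : V (x / 2) (Part.get _ h1) == (x % 2 == 0) with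
    | true => simpa using hv
    | false => simp [hv] at h2
  · rintro ⟨t, ht, hmin, hv⟩
    have hm : t ∈ Nat.rfind fun t => Part.some (E.released L (x / 2) t) :=
      Nat.mem_rfind.2 ⟨by simpa using ht, fun {t'} ht' => by simpa using hmin t' ht'⟩
    refine ⟨Part.dom_iff_mem.2 ⟨t, hm⟩, ?_⟩
    rw [Part.get_eq_of_mem hm]
    simp [hv]

/-- A search succeeds in either case: a released `k` shows its release stage, while an unreleased
one is certified by `C` avoiding the finite list `L k`. -/
theorem releaseSet_reducible (hL : Primrec L) (hV : Primrec₂ V) :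
    TuringReducible (charFun (E.releaseSet L V)) (charFun C) := by
  classical
  -- The first release stage if it is at most `m`, and `m + 1` otherwise.
  let T : ℕ → ℕ → ℕ := fun k m => (List.range (m + 1)).findIdx (E.released L k)
  have hT : Primrec₂ T := Primrec.list_findIdx
    (Primrec.list_range.comp (Primrec.succ.comp Primrec.snd))
    ((E.primrec_released hL).comp (Primrec.fst.comp Primrec.fst) Primrec.snd).to₂
  let blocked : ℕ → List Bool → Bool := fun k σ =>
    (L k).elim false fun l => l.all fun y => σ[y]? == some false
  have hhalf : Primrec fun p : (ℕ × ℕ) × List Bool => p.1.1 / 2 :=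
    Primrec.nat_div.comp (Primrec.fst.comp Primrec.fst) (Primrec.const 2)
  have hbit : Primrec fun o : Option Bool => o == some false := Primrec.dom_finite _
  have hblocked : Primrec fun p : (ℕ × ℕ) × List Bool => blocked (p.1.1 / 2) p.2 := by
    have hall : Primrec₂ fun (p : (ℕ × ℕ) × List Bool) (l : List ℕ) =>
        l.all fun y => p.2[y]? == some false :=
      Primrec.list_all Primrec.snd (hbit.comp (Primrec.list_getElem?.comp
        (Primrec.snd.comp (Primrec.fst.comp Primrec.fst)) Primrec.snd)).to₂
    exact (Primrec.option_casesOn (hL.comp hhalf) (Primrec.const false) hall).of_eq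
      fun p => by cases h : L (p.1.1 / 2) <;> simp [blocked, h]
  have htime : Primrec fun p : (ℕ × ℕ) × List Bool => T (p.1.1 / 2) p.1.2 :=
    hT.comp hhalf (Primrec.snd.comp Primrec.fst)
  have hpar : Primrec fun p : (ℕ × ℕ) × List Bool => p.1.1 % 2 == 0 :=
    Primrec.beq.comp (Primrec.nat_mod.comp (Primrec.fst.comp Primrec.fst) (Primrec.const 2))
      (Primrec.const 0)
  have hvalue : Primrec fun p : (ℕ × ℕ) × List Bool =>
      V (p.1.1 / 2) (T (p.1.1 / 2) p.1.2) == (p.1.1 % 2 == 0) :=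
    Primrec.beq.comp (hV.comp hhalf htime) hpar
  have hTspec : ∀ k m, T k m ≤ m →
      E.released L k (T k m) = true ∧ ∀ t' < T k m, E.released L k t' = false := by
    intro k m h
    have hlt : T k m < (List.range (m + 1)).length := by simpa using Nat.lt_succ_of_le h
    refine ⟨by simpa using List.findIdx_getElem (w := hlt), fun t' ht' => ?_⟩
    simpa using List.not_of_lt_findIdx ht'
  refine turingReducible_of_finite_use
    (v := fun x m σ => bif decide (T (x / 2) m ≤ m) then
        some (bif V (x / 2) (T (x / 2) m) == (x % 2 == 0) then 1 else 0)
      else bif blocked (x / 2) σ then some 0 else none) ?_ ?_ ?_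
  · have htest : Primrec fun p : (ℕ × ℕ) × List Bool => decide (T (p.1.1 / 2) p.1.2 ≤ p.1.2) :=
      Primrec.nat_le.decide.comp htime (Primrec.snd.comp Primrec.fst)
    have hout := Primrec.option_some.comp
      (Primrec.cond hvalue (Primrec.const 1) (Primrec.const 0))
    exact (Primrec.cond htest hout
      (Primrec.cond hblocked (Primrec.const (some 0)) (Primrec.const none))).to_comp
  · intro x
    by_cases h : ∃ t, E.released L (x / 2) t = true
    · obtain ⟨t, ht⟩ := h
      refine ⟨t, ?_⟩
      have hle : T (x / 2) t ≤ t := by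
        have := List.findIdx_lt_length_of_exists (xs := List.range (t + 1))
          (p := E.released L (x / 2)) ⟨t, by simp, ht⟩
        simpa [Nat.lt_succ_iff] using this
      simp [hle]
    · rw [exists_released_iff] at h
      push Not at h
      obtain ⟨l, hl, hC⟩ := h
      -- The sum bounds every element of `l`, so this segment of `C` decides them all.
      refine ⟨l.sum + 1, ?_⟩
      have hb : blocked (x / 2) (initialSegment C (l.sum + 1)) = true := by
        simp only [blocked, hl, Option.elim_some, List.all_eq_true, beq_iff_eq]
        exact fun y hy => getElem?_initialSegment_eq_false.2
          ⟨Nat.lt_succ_of_le (List.le_sum_of_mem hy), hC y hy⟩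
      simp only [hb, cond_true]
      cases decide (T (x / 2) (l.sum + 1) ≤ l.sum + 1) <;> simp
  · intro x m y hy
    by_cases hle : T (x / 2) m ≤ m
    · obtain ⟨h1, h2⟩ := hTspec _ _ hle
      have hmem := E.mem_releaseSet_iff (V := V) h1 h2
      by_cases hx : x ∈ E.releaseSet L V
      · simpa [hle, hx, hmem.1 hx, eq_comm] using hy
      · have := beq_eq_false_iff_ne.2 (mt hmem.2 hx)
        simpa [hle, hx, this, eq_comm] using hy
    · cases hb : blocked (x / 2) (initialSegment C m) with
      | false => simp [hle, hb] at hy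
      | true =>
        have hx : x ∉ E.releaseSet L V := by
          refine E.not_mem_releaseSet fun h => ?_
          cases hl : L (x / 2) with
          | none => simp [blocked, hl] at hb
          | some l =>
            obtain ⟨z, hz, hzC⟩ := E.exists_released_iff.1 h l hl
            simp only [blocked, hl, Option.elim_some, List.all_eq_true, beq_iff_eq] at hb
            exact (getElem?_initialSegment_eq_false.1 (hb z hz)).2 hzC
        simpa [hle, hb, hx, eq_comm] using hy

theorem reducible_releaseSet {code : ℕ → ℕ} (hcode : Computable code)
    (hL : ∀ j, L (code j) = some [j]) (hV : ∀ j t, V (code j) t = true) :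
    TuringReducible (charFun C) (charFun (E.releaseSet L V)) := by
  refine charFun_reducible_of_manyOne (r := fun j => 2 * code j)
    (Primrec.nat_double.to_comp.comp hcode) fun j => ?_
  have hhalf : 2 * code j / 2 = code j := by omega
  have hC : (∃ t, E.released L (code j) t = true) ↔ j ∈ C := by
    simp [exists_released_iff, hL]
  rw [← hC]
  constructor
  · intro h
    obtain ⟨t, ht, hmin⟩ := E.exists_first_released h
    exact ⟨t, by rwa [hhalf], by rwa [hhalf], by simp [hV]⟩
  · rintro ⟨t, ht, -⟩
    exact ⟨t, by rwa [hhalf] at ht⟩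

end StageEnumeration

/-! ### Asymptotic density -/

theorem ncard_inter_Iio_eq_count (A : Set ℕ) [DecidablePred (· ∈ A)] (n : ℕ) :
    (A ∩ Set.Iio n).ncard = Nat.count (· ∈ A) n := by
  rw [Nat.count_eq_card_filter_range, ← Set.ncard_coe_finset]
  congr 1
  ext x
  simp [and_comm]

theorem count_two_mul_add_count {A U : Set ℕ} [DecidablePred (· ∈ A)] [DecidablePred (· ∈ U)]
    (hU : ∀ k ∈ U, 2 * k ∉ A ∧ 2 * k + 1 ∉ A) (hA : ∀ k ∉ U, (2 * k ∈ A ↔ 2 * k + 1 ∉ A)) (m : ℕ) :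
    Nat.count (· ∈ A) (2 * m) + Nat.count (· ∈ U) m = m := by
  induction m with
  | zero => simp
  | succ m ih =>
    rw [show 2 * (m + 1) = 2 * m + 1 + 1 by ring, Nat.count_succ, Nat.count_succ, Nat.count_succ]
    by_cases hm : m ∈ U
    · have := hU m hm
      simp only [hm, this, if_true, if_false]
      omega
    · have := hA m hm
      by_cases h1 : 2 * m + 1 ∈ A
      · simp only [hm, this, h1, not_true, if_true, if_false]
        omega
      · simp only [hm, this, h1, not_false_iff, if_true, if_false]
        omega

theorem count_le_of_finite_not_dvd {U : Set ℕ} [DecidablePred (· ∈ U)] {d : ℕ}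
    (hfin : {k ∈ U | ¬ d ∣ k}.Finite) :
    ∃ B, ∀ n, Nat.count (· ∈ U) n ≤ B + n / d := by
  refine ⟨hfin.toFinset.card + 1, fun n => ?_⟩
  have hsub : (Finset.range n).filter (· ∈ U) ⊆
      hfin.toFinset ∪ (Finset.range (n / d + 1)).image (d * ·) := by
    intro k hk
    simp only [Finset.mem_filter, Finset.mem_range] at hk
    simp only [Finset.mem_union, Set.Finite.mem_toFinset, Finset.mem_image, Finset.mem_range]
    by_cases hd : d ∣ k
    · obtain ⟨q, rfl⟩ := hd
      rcases Nat.eq_zero_or_pos d with rfl | hpos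
      · exact Or.inr ⟨0, by simp⟩
      · refine Or.inr ⟨q, Nat.lt_succ_of_le ((Nat.le_div_iff_mul_le hpos).2 ?_), rfl⟩
        rw [mul_comm]
        exact hk.1.le
    · exact Or.inl ⟨hk.2, hd⟩
  rw [Nat.count_eq_card_filter_range]
  calc _ ≤ _ := Finset.card_le_card hsub
    _ ≤ _ := Finset.card_union_le _ _
    _ ≤ hfin.toFinset.card + (n / d + 1) := by
        gcongr
        simpa using Finset.card_image_le (s := Finset.range (n / d + 1)) (f := (d * ·))
    _ = _ := by ring

/-- Up to one element of a split pair, `A` misses half of an initial segment by at most the number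
of pairs indexed by `U`. Up to finitely many elements, `U` lies in the multiples of `2^J`, so its
upper density is at most `2^(-J)` for every `J`. -/
theorem hasAsymptoticDensity_half {A U : Set ℕ}
    (hU : ∀ k ∈ U, 2 * k ∉ A ∧ 2 * k + 1 ∉ A) (hA : ∀ k ∉ U, (2 * k ∈ A ↔ 2 * k + 1 ∉ A))
    (hfin : ∀ J, {k ∈ U | ¬ 2 ^ J ∣ k}.Finite) : HasAsymptoticDensity A (1 / 2) := by
  classical
  have hdev : ∀ n, |(2 * Nat.count (· ∈ A) n : ℝ) - n| ≤ 2 * (Nat.count (· ∈ U) n : ℝ) + 1 := by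
    intro n
    have key : (n : ℤ) ≤ 2 * Nat.count (· ∈ A) n + 2 * Nat.count (· ∈ U) n + 1 ∧
        (2 * Nat.count (· ∈ A) n : ℤ) ≤ n + 2 * Nat.count (· ∈ U) n + 1 := by
      have hmono : Nat.count (· ∈ U) (n / 2) ≤ Nat.count (· ∈ U) n :=
        Nat.count_monotone _ (Nat.div_le_self _ _)
      have h := count_two_mul_add_count hU hA (n / 2)
      rcases Nat.even_or_odd' n with ⟨m, rfl | rfl⟩
      · rw [Nat.mul_div_cancel_left _ (by norm_num)] at h hmono
        omega
      · rw [show (2 * m + 1) / 2 = m by omega] at h hmono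
        rw [Nat.count_succ (p := (· ∈ A))]
        split_ifs <;> omega
    have h1 : (n : ℝ) ≤ 2 * Nat.count (· ∈ A) n + 2 * Nat.count (· ∈ U) n + 1 := by
      exact_mod_cast key.1
    have h2 : (2 * Nat.count (· ∈ A) n : ℝ) ≤ n + 2 * Nat.count (· ∈ U) n + 1 := by
      exact_mod_cast key.2
    rw [abs_le]
    constructor <;> linarith
  rw [HasAsymptoticDensity, Metric.tendsto_atTop]
  intro ε hε
  obtain ⟨J, hJ⟩ := exists_pow_lt_of_lt_one (half_pos hε) (show (1 / 2 : ℝ) < 1 by norm_num)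
  obtain ⟨B, hB⟩ := count_le_of_finite_not_dvd (hfin J)
  obtain ⟨N, hN⟩ := exists_nat_gt ((B + 1 : ℝ) / (ε / 2))
  refine ⟨N + 1, fun n hn => ?_⟩
  have hn0 : (0 : ℝ) < n := by exact_mod_cast (show 0 < n by omega)
  have hNn : (N : ℝ) ≤ n := by exact_mod_cast (show N ≤ n by omega)
  rw [ncard_inter_Iio_eq_count, Real.dist_eq]
  have hcount : (Nat.count (· ∈ U) n : ℝ) ≤ B + n * (1 / 2) ^ J := by
    have h1 : (Nat.count (· ∈ U) n : ℝ) ≤ B + ((n / 2 ^ J : ℕ) : ℝ) := by exact_mod_cast hB n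
    have h2 : ((n / 2 ^ J : ℕ) : ℝ) ≤ n / (2 ^ J : ℕ) := Nat.cast_div_le
    have h3 : (n : ℝ) / (2 ^ J : ℕ) = n * (1 / 2) ^ J := by
      push_cast
      rw [one_div, inv_pow, div_eq_mul_inv]
    linarith
  have hB' : (B + 1 : ℝ) < n * (ε / 2) := by
    rw [div_lt_iff₀ (half_pos hε)] at hN
    nlinarith
  have heq : (Nat.count (· ∈ A) n : ℝ) / n - 1 / 2 =
      (2 * Nat.count (· ∈ A) n - n) / (2 * n) := by
    field_simp
  rw [heq, abs_div, abs_of_pos (show (0 : ℝ) < 2 * n by positivity),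
    div_lt_iff₀ (by positivity)]
  have := hdev n
  nlinarith [mul_lt_mul_of_pos_left hJ hn0]

/-- The `2^d` missing numbers all lie below `2^(j+3+d)`, so infinitely often a fraction `2^(-(j+3))`
of an initial segment is missing. -/
theorem not_hasAsymptoticDensity_one {D : Set ℕ} (j : ℕ)
    (hD : ∀ b, ∃ d ≥ b, ∀ r, 2 ^ d ≤ r → r < 2 ^ (d + 1) → 2 * (2 ^ j * (2 * r + 1)) ∉ D) :
    ¬ HasAsymptoticDensity D 1 := by
  classical
  intro h
  rw [HasAsymptoticDensity, Metric.tendsto_atTop] at h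
  obtain ⟨N, hN⟩ := h ((1 / 2) ^ (j + 3)) (by positivity)
  obtain ⟨d, hd, hr⟩ := hD N
  have hNd : N ≤ 2 ^ (j + 3 + d) :=
    (hd.trans (Nat.le_add_left _ _)).trans Nat.lt_two_pow_self.le
  have hcount : (D ∩ Set.Iio (2 ^ (j + 3 + d))).ncard + 2 ^ d ≤ 2 ^ (j + 3 + d) := by
    let f : ℕ → ℕ := fun r => 2 * (2 ^ j * (2 * r + 1))
    have hf : Function.Injective f := by
      intro a b hab
      have h1 : 2 ^ j * (2 * a + 1) = 2 ^ j * (2 * b + 1) := by simpa [f] using hab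
      have h2 := Nat.eq_of_mul_eq_mul_left (show 0 < 2 ^ j by positivity) h1
      omega
    rw [ncard_inter_Iio_eq_count, Nat.count_eq_card_filter_range]
    have hdisj : Disjoint ((Finset.range (2 ^ (j + 3 + d))).filter (· ∈ D))
        ((Finset.Ico (2 ^ d) (2 ^ (d + 1))).image f) := by
      rw [Finset.disjoint_left]
      intro x hx hx'
      obtain ⟨r, hr', rfl⟩ := Finset.mem_image.1 hx'
      rw [Finset.mem_Ico] at hr'
      exact hr r hr'.1 hr'.2 (Finset.mem_filter.1 hx).2
    have hsub : (Finset.range (2 ^ (j + 3 + d))).filter (· ∈ D) ∪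
        (Finset.Ico (2 ^ d) (2 ^ (d + 1))).image f ⊆ Finset.range (2 ^ (j + 3 + d)) := by
      refine Finset.union_subset (Finset.filter_subset _ _) ?_
      intro x hx
      obtain ⟨r, hr', rfl⟩ := Finset.mem_image.1 hx
      rw [Finset.mem_Ico] at hr'
      rw [Finset.mem_range]
      have h1 : 2 * r + 1 < 2 ^ (d + 2) := by
        have := hr'.2
        rw [pow_succ] at this ⊢
        omega
      calc f r = 2 ^ (j + 1) * (2 * r + 1) := by simp only [f]; ring
        _ < 2 ^ (j + 1) * 2 ^ (d + 2) := by gcongr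
        _ = 2 ^ (j + 3 + d) := by ring
    have hcard := Finset.card_le_card hsub
    rw [Finset.card_union_of_disjoint hdisj, Finset.card_image_of_injective _ hf,
      Nat.card_Ico, Finset.card_range] at hcard
    have : 2 ^ (d + 1) - 2 ^ d = 2 ^ d := by
      rw [pow_succ]
      omega
    omega
  have hlt := hN _ hNd
  rw [Real.dist_eq, abs_lt] at hlt
  have hpos : (0 : ℝ) < 2 ^ (j + 3 + d) := by positivity
  have hcast : ((D ∩ Set.Iio (2 ^ (j + 3 + d))).ncard : ℝ) + 2 ^ d ≤ 2 ^ (j + 3 + d) := by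
    exact_mod_cast hcount
  have hle : ((D ∩ Set.Iio (2 ^ (j + 3 + d))).ncard : ℝ) / 2 ^ (j + 3 + d) ≤
      1 - (1 / 2) ^ (j + 3) := by
    rw [div_le_iff₀ hpos]
    have : (1 / 2 : ℝ) ^ (j + 3) * 2 ^ (j + 3 + d) = 2 ^ d := by
      rw [pow_add 2 (j + 3) d, ← mul_assoc, ← mul_pow]
      norm_num
    linarith
  push_cast at hlt
  linarith [hlt.1]

/-! ### Primitive recursive auxiliaries and halting times -/

/-- The positions of the entries `false` of a list of Booleans. -/
def zeroPositions (σ : List Bool) : List ℕ :=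
  (List.range σ.length).filter fun x => σ[x]? = some false

theorem mem_zeroPositions {σ : List Bool} {x : ℕ} :
    x ∈ zeroPositions σ ↔ σ[x]? = some false := by
  simp only [zeroPositions, List.mem_filter, List.mem_range, decide_eq_true_eq,
    and_iff_right_iff_imp]
  intro h
  by_contra hlt
  rw [List.getElem?_eq_none (not_lt.1 hlt)] at h
  cases h

theorem primrec_zeroPositions : Primrec zeroPositions := by
  have hbit : PrimrecPred fun p : List Bool × ℕ => p.1[p.2]? = some false :=
    Primrec.eq.comp (Primrec.list_getElem?.comp Primrec.fst Primrec.snd) (Primrec.const _)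
  have hkeep : Primrec₂ fun (σ : List Bool) (x : ℕ) =>
      if σ[x]? = some false then some x else none :=
    Primrec.ite hbit (Primrec.option_some.comp Primrec.snd) (Primrec.const none)
  refine (Primrec.listFilterMap (Primrec.list_range.comp Primrec.list_length) hkeep).of_eq
    fun σ => ?_
  rw [zeroPositions, ← List.filterMap_eq_filter]
  simp [Option.guard]

theorem primrec_two_pow : Primrec fun n : ℕ => 2 ^ n :=
  (Primrec₂.unpaired'.1 Nat.Primrec.pow).comp (Primrec.const 2) Primrec.id

/-- The exponent of `2` in a positive number. -/
def twoExponent (k : ℕ) : ℕ := Nat.findGreatest (2 ^ · ∣ k) k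

/-- The binary logarithm of a positive number. -/
def binaryLog (k : ℕ) : ℕ := Nat.findGreatest (2 ^ · ≤ k) k

theorem two_pow_dvd_iff_le_twoExponent {k j : ℕ} (hk : k ≠ 0) :
    2 ^ j ∣ k ↔ j ≤ twoExponent k := by
  constructor
  · intro h
    exact Nat.le_findGreatest (Nat.lt_two_pow_self.le.trans
      (Nat.le_of_dvd (Nat.pos_of_ne_zero hk) h)) h
  · intro h
    refine (pow_dvd_pow 2 h).trans ?_
    exact Nat.findGreatest_spec (P := (2 ^ · ∣ k)) (Nat.zero_le _) (by simp)

theorem twoExponent_mul_odd (j r : ℕ) : twoExponent (2 ^ j * (2 * r + 1)) = j := by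
  have hk : 2 ^ j * (2 * r + 1) ≠ 0 := by positivity
  refine le_antisymm ?_ ((two_pow_dvd_iff_le_twoExponent hk).1 (dvd_mul_right _ _))
  by_contra hlt
  have h := (two_pow_dvd_iff_le_twoExponent hk).2 (Nat.lt_of_not_le hlt)
  rw [pow_succ, Nat.mul_dvd_mul_iff_left (by positivity)] at h
  omega

theorem twoExponent_two_pow (j : ℕ) : twoExponent (2 ^ j) = j := by
  simpa using twoExponent_mul_odd j 0

theorem le_binaryLog_iff {k s : ℕ} (hk : k ≠ 0) : s ≤ binaryLog k ↔ 2 ^ s ≤ k := by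
  constructor
  · intro h
    refine (pow_le_pow_right₀ one_le_two h).trans ?_
    exact Nat.findGreatest_spec (P := (2 ^ · ≤ k)) (Nat.zero_le _)
      (by simpa using Nat.one_le_iff_ne_zero.2 hk)
  · intro h
    exact Nat.le_findGreatest (Nat.lt_two_pow_self.le.trans h) h

theorem primrec_twoExponent : Primrec twoExponent := by
  have hdvd : PrimrecRel fun (k j : ℕ) => 2 ^ j ∣ k :=
    (PrimrecPred.of_eq (Primrec.eq.comp
      (Primrec.nat_mod.comp Primrec.fst (primrec_two_pow.comp Primrec.snd)) (Primrec.const 0))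
      fun p : ℕ × ℕ => (Nat.dvd_iff_mod_eq_zero (n := p.1)).symm).primrecRel
  exact Primrec.nat_findGreatest Primrec.id hdvd

theorem primrec_binaryLog : Primrec binaryLog := by
  have hle : PrimrecRel fun (k s : ℕ) => 2 ^ s ≤ k :=
    (Primrec.nat_le.comp (primrec_two_pow.comp Primrec.snd) Primrec.fst).primrecRel
  exact Primrec.nat_findGreatest Primrec.id hle

/-- A total program halts on all inputs below `2 ^ (s + 2)` within a number of steps that is
computable and monotone in `s`. -/
theorem exists_convergence_bound {code : Code} (htotal : ∀ x, (code.eval x).Dom) :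
    ∃ h : ℕ → ℕ, Computable h ∧ Monotone h ∧
      ∀ s, ∀ x < 2 ^ (s + 2), (code.evaln (h s) x).isSome := by
  have hex : ∀ x, ∃ t, (code.evaln t x).isSome = true := fun x => by
    obtain ⟨y, hy⟩ := Part.dom_iff_mem.1 (htotal x)
    obtain ⟨t, ht⟩ := Code.evaln_complete.1 hy
    exact ⟨t, Option.isSome_iff_exists.2 ⟨y, ht⟩⟩
  have hstep : Primrec fun p : ℕ × ℕ => (code.evaln p.2 p.1).isSome :=
    Primrec.option_isSome.comp (Code.primrec_evaln.comp
      ((Primrec.snd.pair (Primrec.const code)).pair Primrec.fst))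
  have hfind : Computable fun x => Nat.find (hex x) :=
    Computable.find (Primrec.eq.comp hstep (Primrec.const true)).computablePred hex
  -- The maximum of the halting times on the inputs below `n`.
  let M : ℕ → ℕ := fun n => Nat.rec 0 (fun x r => max r (Nat.find (hex x))) n
  have hM : Computable M := by
    have hmax : Computable₂ fun (_ : ℕ) (p : ℕ × ℕ) => max p.2 (Nat.find (hex p.1)) :=
      Primrec.nat_max.to_comp.comp (Computable.snd.comp Computable.snd)
        (hfind.comp (Computable.fst.comp Computable.snd))
    exact Computable.nat_rec Computable.id (Computable.const 0) hmax
  have hmono : Monotone M := monotone_nat_of_le_succ fun n => le_max_left _ _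
  refine ⟨fun s => M (2 ^ (s + 2)), ?_, ?_, ?_⟩
  · exact hM.comp (primrec_two_pow.comp
      (Primrec.nat_add.comp Primrec.id (Primrec.const 2))).to_comp
  · exact fun s t hst => hmono (pow_le_pow_right₀ one_le_two (by omega))
  · intro s x hx
    obtain ⟨y, hy⟩ := Option.isSome_iff_exists.1 (Nat.find_spec (hex x))
    exact Option.isSome_iff_exists.2
      ⟨y, Code.evaln_mono ((le_max_right _ _).trans (hmono (Nat.succ_le_of_lt hx))) hy⟩

/-! ### Approximating the jump of `C` -/

namespace StageEnumeration

variable {C : Set ℕ} (E : StageEnumeration C)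

/-- The initial segment of length `u` of the part of `C` enumerated by stage `s`. -/
def stageSegment (s u : ℕ) : List Bool := (List.range u).map (E.stage s)

@[simp] theorem length_stageSegment (s u : ℕ) : (E.stageSegment s u).length = u := by
  simp [stageSegment]

theorem getElem?_stageSegment_eq_false {s u x : ℕ} :
    (E.stageSegment s u)[x]? = some false ↔ x < u ∧ E.stage s x = false := by
  by_cases h : x < u <;> simp [stageSegment, h]

theorem stageSegment_eq_initialSegment_iff {s u : ℕ} :
    E.stageSegment s u = initialSegment C u ↔ ∀ x < u, x ∈ C → E.stage s x = true := by
  classical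
  simp only [stageSegment, initialSegment, List.map_inj_left, List.mem_range]
  refine forall₂_congr fun x _ => ?_
  rw [Bool.eq_iff_iff, decide_eq_true_iff]
  exact ⟨fun h => h.2, fun h => ⟨fun hs => E.mem_iff.2 ⟨s, hs⟩, h⟩⟩

theorem exists_stageSegment_eq (u : ℕ) :
    ∃ b, ∀ s ≥ b, E.stageSegment s u = initialSegment C u := by
  induction u with
  | zero => exact ⟨0, fun s _ => by simp [stageSegment, initialSegment]⟩
  | succ u ih =>
    obtain ⟨b, hb⟩ := ih
    by_cases hu : u ∈ C
    · obtain ⟨t, ht⟩ := E.mem_iff.1 hu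
      refine ⟨max b t, fun s hs => E.stageSegment_eq_initialSegment_iff.2 fun x hx hxC => ?_⟩
      rcases Nat.lt_succ_iff_lt_or_eq.1 hx with hlt | rfl
      · exact E.stageSegment_eq_initialSegment_iff.1 (hb s (le_of_max_le_left hs)) x hlt hxC
      · exact E.mono (le_of_max_le_right hs) ht
    · refine ⟨b, fun s hs => E.stageSegment_eq_initialSegment_iff.2 fun x hx hxC => ?_⟩
      rcases Nat.lt_succ_iff_lt_or_eq.1 hx with hlt | rfl
      · exact E.stageSegment_eq_initialSegment_iff.1 (hb s hs) x hlt hxC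
      · exact absurd hxC hu

/-- Whether, within `s` steps, the `i`-th functional halts on input `i` with the oracle
`E.stageSegment s u`. -/
def haltsBy (i s u : ℕ) : Bool :=
  ((ofNat Code i).evaln s (encode (i, E.stageSegment s u))).isSome

/-- The first initial segment of the part of `C` enumerated by stage `s` with which the `i`-th
functional halts on input `i` within `s` steps. -/
def computation (i s : ℕ) : Option (List Bool) :=
  (List.range (s + 1)).findSome? fun u =>
    if E.haltsBy i s u = true then some (E.stageSegment s u) else none

theorem computation_eq_some {i s : ℕ} {σ : List Bool} (h : E.computation i s = some σ) :
    E.stageSegment s σ.length = σ ∧ ((ofNat Code i).eval (encode (i, σ))).Dom := by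
  obtain ⟨u, -, hu⟩ := List.exists_of_findSome?_eq_some h
  split_ifs at hu with hhalt
  obtain rfl := Option.some_inj.1 hu
  obtain ⟨y, hy⟩ := Option.isSome_iff_exists.1 hhalt
  exact ⟨by simp, Part.dom_iff_mem.2 ⟨y, Code.evaln_sound hy⟩⟩

/-- Elements only enter `C`, so a string read off at some stage can be wrong only at its zeros. -/
theorem mem_turingJump_of_computation {i s : ℕ} {σ : List Bool}
    (h : E.computation i s = some σ) (hσ : ∀ x ∈ zeroPositions σ, x ∉ C) : i ∈ turingJump C := by
  obtain ⟨h1, h2⟩ := E.computation_eq_some h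
  have h3 : σ = initialSegment C σ.length := by
    refine h1.symm.trans (E.stageSegment_eq_initialSegment_iff.2 fun x hx hxC => ?_)
    by_contra hs
    refine hσ x (mem_zeroPositions.2 ?_) hxC
    rw [← h1, E.getElem?_stageSegment_eq_false]
    exact ⟨hx, by simpa using hs⟩
  exact ⟨σ.length, by rwa [← h3]⟩

/-- Take the shortest initial segment of `C` that makes the computation halt. Once `C` has settled
up to its length, no shorter string can be found, and this one is found as soon as there are enough
steps. -/
theorem exists_computation_eq {i : ℕ} (hi : i ∈ turingJump C) :
    ∃ u b, ∀ s ≥ b, E.computation i s = some (initialSegment C u) := by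
  classical
  have hex : ∃ k, ((ofNat Code i).eval (encode (i, initialSegment C k))).Dom := hi
  obtain ⟨y, hy⟩ := Part.dom_iff_mem.1 (Nat.find_spec hex)
  obtain ⟨t, ht⟩ := Code.evaln_complete.1 hy
  obtain ⟨b, hb⟩ := E.exists_stageSegment_eq (Nat.find hex)
  refine ⟨Nat.find hex, max (max b t) (Nat.find hex), fun s hs => ?_⟩
  have hbs : b ≤ s := (le_max_left _ _).trans ((le_max_left _ _).trans hs)
  have hts : t ≤ s := (le_max_right _ _).trans ((le_max_left _ _).trans hs)
  have hus : Nat.find hex ≤ s := (le_max_right _ _).trans hs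
  have hseg : ∀ u ≤ Nat.find hex, E.stageSegment s u = initialSegment C u := fun u hu =>
    E.stageSegment_eq_initialSegment_iff.2 fun x hx =>
      E.stageSegment_eq_initialSegment_iff.1 (hb s hbs) x (hx.trans_le hu)
  have hrange : List.range (s + 1) = List.range (Nat.find hex) ++
      Nat.find hex :: (List.range (s - Nat.find hex)).map (Nat.find hex + 1 + ·) := by
    have : s + 1 = Nat.find hex + 1 + (s - Nat.find hex) := by omega
    rw [this, List.range_add, List.range_succ]
    simp
  refine List.findSome?_eq_some_iff.2 ⟨_, _, _, hrange, ?_, fun u hu => ?_⟩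
  · have : E.haltsBy i s (Nat.find hex) = true := by
      rw [haltsBy, hseg _ le_rfl]
      exact Option.isSome_iff_exists.2 ⟨y, Code.evaln_mono hts ht⟩
    rw [if_pos this, hseg _ le_rfl]
  · rw [List.mem_range] at hu
    refine if_neg fun hhalt => Nat.find_min hex hu ?_
    rw [haltsBy, hseg u hu.le] at hhalt
    obtain ⟨z, hz⟩ := Option.isSome_iff_exists.1 hhalt
    exact Part.dom_iff_mem.2 ⟨z, Code.evaln_sound hz⟩

theorem primrec_computation : Primrec₂ E.computation := by
  have hseg : Primrec₂ E.stageSegment := Primrec.list_map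
    (Primrec.list_range.comp Primrec.snd)
    (E.primrec.comp (Primrec.fst.comp Primrec.fst) Primrec.snd).to₂
  have hi : Primrec fun q : (ℕ × ℕ) × ℕ => q.1.1 := Primrec.fst.comp Primrec.fst
  have hsg : Primrec fun q : (ℕ × ℕ) × ℕ => E.stageSegment q.1.2 q.2 :=
    hseg.comp (Primrec.snd.comp Primrec.fst) Primrec.snd
  have hin : Primrec fun q : (ℕ × ℕ) × ℕ => encode (q.1.1, E.stageSegment q.1.2 q.2) :=
    Primrec.encode.comp (hi.pair hsg)
  have hcode : Primrec fun q : (ℕ × ℕ) × ℕ => ofNat Code q.1.1 := (Primrec.ofNat Code).comp hi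
  have hhalt : Primrec fun q : (ℕ × ℕ) × ℕ => E.haltsBy q.1.1 q.1.2 q.2 :=
    Primrec.option_isSome.comp (Code.primrec_evaln.comp
      (((Primrec.snd.comp Primrec.fst).pair hcode).pair hin))
  have hcand : Primrec₂ fun (p : ℕ × ℕ) (u : ℕ) =>
      if E.haltsBy p.1 p.2 u = true then some (E.stageSegment p.2 u) else none :=
    Primrec.ite (Primrec.eq.comp hhalt (Primrec.const true)) (Primrec.option_some.comp hsg)
      (Primrec.const none)
  have hlist : Primrec fun p : ℕ × ℕ => List.range (p.2 + 1) :=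
    Primrec.list_range.comp (Primrec.succ.comp Primrec.snd)
  exact (Primrec.list_head?.comp (Primrec.listFilterMap hlist hcand)).of_eq
    fun p => List.head?_filterMap

/-- If the computation of the `i`-th functional on `i` found at stage `s` was not already there at
the previous stage, then the numbers that must stay outside `C` to preserve it. -/
def restraint (i s : ℕ) : Option (List ℕ) :=
  if s ≠ 0 ∧ E.computation i (s - 1) = E.computation i s then none
  else (E.computation i s).map zeroPositions

theorem restraint_eq_some {i s : ℕ} {l : List ℕ} (h : E.restraint i s = some l) :
    ∃ σ, E.computation i s = some σ ∧ zeroPositions σ = l := by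
  rw [restraint] at h
  split_ifs at h
  simpa using h

theorem primrec_restraint : Primrec₂ E.restraint := by
  have hnow : Primrec fun p : ℕ × ℕ => E.computation p.1 p.2 := E.primrec_computation
  have hprev : Primrec fun p : ℕ × ℕ => E.computation p.1 (p.2 - 1) :=
    E.primrec_computation.comp Primrec.fst (Primrec.pred.comp Primrec.snd)
  exact Primrec.ite
    (((Primrec.eq.comp Primrec.snd (Primrec.const 0)).not).and (Primrec.eq.comp hprev hnow))
    (Primrec.const none)
    (Primrec.option_map hnow (primrec_zeroPositions.comp Primrec.snd).to₂)

/-- Each functional is responsible for only finitely many restraints that are never violated. -/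
theorem exists_restraint_violated (i : ℕ) :
    ∃ b, ∀ s ≥ b, ∀ l, E.restraint i s = some l → ∃ x ∈ l, x ∈ C := by
  by_cases hi : i ∈ turingJump C
  · obtain ⟨u, b, hb⟩ := E.exists_computation_eq hi
    refine ⟨b + 1, fun s hs l hl => ?_⟩
    rw [restraint, if_pos ⟨by omega, by rw [hb s (by omega), hb (s - 1) (by omega)]⟩] at hl
    cases hl
  · refine ⟨0, fun s _ l hl => ?_⟩
    obtain ⟨σ, hσ, rfl⟩ := E.restraint_eq_some hl
    by_contra! h
    exact hi (E.mem_turingJump_of_computation hσ h)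

/-- If `C` is not low then, for every computable delay `h`, some functional imposes infinitely
many restraints that are violated, but only after the delay. -/
theorem exists_frequently_restraint_violated_late (hlow : ¬ IsLowSet C) {h : ℕ → ℕ}
    (hh : Computable h) (hmono : Monotone h) :
    ∃ i, ∀ b, ∃ s ≥ b, ∃ l, E.restraint i s = some l ∧
      (∀ x ∈ l, E.stage (h s) x = false) ∧ ∃ x ∈ l, x ∈ C := by
  by_contra! hcon
  -- Approximation to `C'`: believe the computation seen at stage `s` if none of its zeros has
  -- entered `C` by stage `h s`.
  refine hlow (isLowSet_of_limit (g := fun i s => (E.computation i s).elim false fun σ =>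
    (zeroPositions σ).all fun x => !E.stage (h s) x) ?_ fun i => ?_)
  · have htest : Primrec₂ fun (q : (ℕ × ℕ) × ℕ) (σ : List Bool) =>
        (zeroPositions σ).all fun x => !E.stage q.2 x :=
      Primrec.list_all (primrec_zeroPositions.comp Primrec.snd)
        (Primrec.not.comp (E.primrec.comp
          (Primrec.snd.comp (Primrec.fst.comp Primrec.fst)) Primrec.snd)).to₂
    have hall : Primrec fun q : (ℕ × ℕ) × ℕ => (E.computation q.1.1 q.1.2).elim false fun σ =>
        (zeroPositions σ).all fun x => !E.stage q.2 x :=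
      (Primrec.option_casesOn (E.primrec_computation.comp (Primrec.fst.comp Primrec.fst)
        (Primrec.snd.comp Primrec.fst)) (Primrec.const false) htest).of_eq
        fun q => by cases hc : E.computation q.1.1 q.1.2 <;> simp
    have hdelay : Computable fun p : ℕ × ℕ => (p, h p.2) :=
      Computable.id.pair (hh.comp Computable.snd)
    have hg := hall.to_comp.comp hdelay
    exact hg
  · by_cases hi : i ∈ turingJump C
    · obtain ⟨u, b, hb⟩ := E.exists_computation_eq hi
      refine ⟨b, fun s hs => iff_of_true ?_ hi⟩
      simp only [hb s hs, Option.elim_some, List.all_eq_true, Bool.not_eq_true', mem_zeroPositions,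
        getElem?_initialSegment_eq_false]
      intro x hx
      by_contra hst
      exact hx.2 (E.mem_iff.2 ⟨h s, by simpa using hst⟩)
    · obtain ⟨b, hb⟩ := hcon i
      -- After `b`, a new computation surviving its delay would be permanent and put `i` into `C'`.
      -- So any believed computation is the one already present at `b`; monotonicity of `h` carries
      -- its survival back to earlier stages.
      have hrun : ∀ s ≥ b, ∀ σ, E.computation i s = some σ →
          (∀ x ∈ zeroPositions σ, E.stage (h s) x = false) → E.computation i b = some σ := by
        intro s hs
        induction s, hs using Nat.le_induction with
        | base => exact fun σ hσ _ => hσ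
        | succ s hs ih =>
          intro σ hσ hst
          by_cases hnew : E.computation i s = E.computation i (s + 1)
          · refine ih σ (hnew.trans hσ) fun x hx => ?_
            by_contra hx'
            have := E.mono (hmono s.le_succ) (by simpa using hx')
            simp [hst x hx] at this
          · have hres : E.restraint i (s + 1) = some (zeroPositions σ) := by
              rw [restraint, if_neg (by simpa using hnew), hσ, Option.map_some]
            exact absurd (E.mem_turingJump_of_computation hσ
              (hb (s + 1) (hs.trans s.le_succ) _ hres hst)) hi
      -- The computation present at `b` is itself destroyed eventually, as `i ∉ C'`.
      have hend : ∃ N, ∀ s ≥ N, E.computation i s ≠ none →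
          E.computation i s ≠ E.computation i b := by
        cases hσ : E.computation i b with
        | none => exact ⟨0, fun s _ hs => hs⟩
        | some σ =>
          obtain ⟨x, hx, hxC⟩ : ∃ x ∈ zeroPositions σ, x ∈ C := by
            by_contra! hx
            exact hi (E.mem_turingJump_of_computation hσ hx)
          obtain ⟨N, hN⟩ := E.mem_iff.1 hxC
          refine ⟨N, fun s hs _ heq => ?_⟩
          rw [mem_zeroPositions, ← (E.computation_eq_some heq).1,
            E.getElem?_stageSegment_eq_false] at hx
          simp [E.mono hs hN] at hx
      obtain ⟨N, hN⟩ := hend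
      refine ⟨max b N, fun s hs => iff_of_false (fun hg => ?_) hi⟩
      cases hσ : E.computation i s with
      | none => simp [hσ] at hg
      | some σ =>
        simp only [hσ, Option.elim_some, List.all_eq_true, Bool.not_eq_true'] at hg
        have hσb := hrun s (le_of_max_le_left hs) σ hσ hg
        exact hN s (le_of_max_le_right hs) (by simp [hσ]) (hσ.trans hσb.symm)

/-! ### The construction and its verification -/

/-- The list of numbers whose enumeration into `C` releases `k`: the powers of `2` code `C`, and
the other numbers respect the restraint given by their exponent of `2` and their size. -/
def releaseList (k : ℕ) : Option (List ℕ) :=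
  if k = 2 ^ twoExponent k then some [twoExponent k]
  else E.restraint (twoExponent k).unpair.2 (binaryLog k)

theorem primrec_releaseList : Primrec E.releaseList := by
  refine Primrec.ite (Primrec.eq.comp Primrec.id (primrec_two_pow.comp primrec_twoExponent))
    ?_ ?_
  · exact Primrec.option_some.comp (Primrec.list_cons.comp primrec_twoExponent (Primrec.const []))
  · exact E.primrec_restraint.comp
      (Primrec.snd.comp (Primrec.unpair.comp primrec_twoExponent)) primrec_binaryLog

/-- Only the exponents below `J` matter. Each contributes one power of `2`, and otherwise only
numbers whose logarithm is below the bound of `exists_restraint_violated`. -/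
theorem finite_never_released (J : ℕ) :
    {k ∈ {k | ¬ ∃ t, E.released E.releaseList k t = true} | ¬ 2 ^ J ∣ k}.Finite := by
  choose b hb using E.exists_restraint_violated
  let B := (Finset.range J).sup fun j => b j.unpair.2
  refine (Set.finite_Iio (2 ^ (J + B))).subset fun k hk => ?_
  obtain ⟨hU, hJ⟩ := hk
  have hk0 : k ≠ 0 := by
    rintro rfl
    exact hJ (dvd_zero _)
  rw [two_pow_dvd_iff_le_twoExponent hk0, not_le] at hJ
  rw [Set.mem_ofPred_eq, exists_released_iff, releaseList] at hU
  rw [Set.mem_Iio]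
  split_ifs at hU with hpow
  · rw [hpow]
    exact Nat.pow_lt_pow_right one_lt_two (by omega)
  · have hlog : ¬ b (twoExponent k).unpair.2 ≤ binaryLog k := fun hle => hU (hb _ _ hle)
    have hB : b (twoExponent k).unpair.2 ≤ B :=
      Finset.le_sup (f := fun j : ℕ => b j.unpair.2) (Finset.mem_range.2 hJ)
    rw [le_binaryLog_iff hk0, not_le] at hlog
    exact hlog.trans_le (pow_le_pow_right₀ one_le_two (by omega))

end StageEnumeration

/-- The side chosen for `k` at stage `t`: it disagrees with the value at `2 * k` of the program
given by the exponent of `2` in `k`, if this value is known by stage `t`. -/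
def diagonalValue (k t : ℕ) : Bool :=
  decide (k = 2 ^ twoExponent k) ||
    !decide ((ofNat Code (twoExponent k).unpair.1).evaln t (2 * k) = some 1)

theorem primrec_diagonalValue : Primrec₂ diagonalValue := by
  have hexp : Primrec fun p : ℕ × ℕ => twoExponent p.1 := primrec_twoExponent.comp Primrec.fst
  have hcode : Primrec fun p : ℕ × ℕ => ofNat Code (twoExponent p.1).unpair.1 :=
    (Primrec.ofNat Code).comp (Primrec.fst.comp (Primrec.unpair.comp hexp))
  have hrun : Primrec fun p : ℕ × ℕ =>
      (ofNat Code (twoExponent p.1).unpair.1).evaln p.2 (2 * p.1) :=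
    Code.primrec_evaln.comp
      ((Primrec.snd.pair hcode).pair (Primrec.nat_double.comp Primrec.fst))
  exact Primrec.or.comp (Primrec.eq.decide.comp Primrec.fst (primrec_two_pow.comp hexp))
    (Primrec.not.comp (Primrec.eq.decide.comp hrun (Primrec.const (some 1))))

namespace StageEnumeration

variable {C : Set ℕ} (E : StageEnumeration C)

/-- The power `2^j` waits for `j` and always chooses the even side, so `2 * 2^j` belongs to the set
exactly when `j ∈ C`. -/
theorem turingDegreeOf_releaseSet :
    turingDegreeOf (E.releaseSet E.releaseList diagonalValue) = turingDegreeOf C :=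
  turingDegreeOf_eq_iff.2
    ⟨E.releaseSet_reducible E.primrec_releaseList primrec_diagonalValue,
      E.reducible_releaseSet primrec_two_pow.to_comp
        (fun j => by simp [releaseList, twoExponent_two_pow])
        (fun j t => by simp [diagonalValue, twoExponent_two_pow])⟩

theorem hasAsymptoticDensity_releaseSet {L : ℕ → Option (List ℕ)} {V : ℕ → ℕ → Bool}
    (hfin : ∀ J, {k ∈ {k | ¬ ∃ t, E.released L k t = true} | ¬ 2 ^ J ∣ k}.Finite) :
    HasAsymptoticDensity (E.releaseSet L V) (1 / 2) := by
  have h0 : ∀ k, 2 * k / 2 = k := fun k => by omega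
  have h1 : ∀ k, (2 * k + 1) / 2 = k := fun k => by omega
  refine hasAsymptoticDensity_half (fun k hk => ⟨?_, ?_⟩) (fun k hk => ?_) hfin
  · exact E.not_mem_releaseSet (by rw [h0]; exact hk)
  · exact E.not_mem_releaseSet (by rw [h1]; exact hk)
  · obtain ⟨t, ht, hmin⟩ := E.exists_first_released (not_not.1 hk)
    have e0 := E.mem_releaseSet_iff (V := V) (x := 2 * k) (by rwa [h0]) (by rwa [h0])
    have e1 := E.mem_releaseSet_iff (V := V) (x := 2 * k + 1) (by rwa [h1]) (by rwa [h1])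
    rw [e0, e1, h0, h1]
    simp [Nat.add_mod]

theorem not_isCoarselyComputable_releaseSet (hlow : ¬ IsLowSet C) :
    ¬ IsCoarselyComputable (E.releaseSet E.releaseList diagonalValue) := by
  rintro ⟨D, ⟨_, hD⟩, hdens⟩
  have hchar : Computable fun x => bif decide (x ∈ D) then 1 else 0 :=
    Computable.cond hD (Computable.const 1) (Computable.const 0)
  obtain ⟨code, hcode⟩ := Code.exists_code.1 (Partrec.nat_iff.1 hchar.partrec)
  have heval : ∀ x, code.eval x = Part.some (bif decide (x ∈ D) then 1 else 0) := fun x => by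
    rw [hcode]
    rfl
  obtain ⟨h, hh, hmono, hconv⟩ := exists_convergence_bound (code := code)
    fun x => by rw [heval]; trivial
  obtain ⟨i, hi⟩ := E.exists_frequently_restraint_violated_late hlow hh hmono
  let j := Nat.pair (encode code) i
  refine not_hasAsymptoticDensity_one j (fun b => ?_) hdens
  -- For `2^d ≤ r < 2^(d+1)` the number `2^j * (2r+1)` has logarithm `j + 1 + d`; the shift by `j +
  -- 1` yields `d ≥ b`.
  obtain ⟨s, hs, l, hl, hlate, hviol⟩ := hi (b + j + 1)
  obtain ⟨d, rfl⟩ : ∃ d, s = j + 1 + d := ⟨s - (j + 1), by omega⟩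
  refine ⟨d, by omega, fun r hr1 hr2 hagree => ?_⟩
  set k := 2 ^ j * (2 * r + 1) with hk
  have hexp : twoExponent k = j := twoExponent_mul_odd j r
  have hk0 : k ≠ 0 := by positivity
  have hlt : k < 2 ^ (j + 1 + d + 1) := by
    rw [show j + 1 + d + 1 = j + (d + 1 + 1) by ring, pow_add, hk]
    gcongr
    rw [pow_succ]
    omega
  have hlog : binaryLog k = j + 1 + d := by
    refine le_antisymm (Nat.lt_succ_iff.1 ?_) ((le_binaryLog_iff hk0).2 ?_)
    · rw [← not_le, Nat.succ_eq_add_one, le_binaryLog_iff hk0]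
      exact not_le.2 hlt
    · rw [show j + 1 + d = j + (d + 1) by ring, pow_add, hk]
      gcongr
      rw [pow_succ]
      omega
  have hnpow : k ≠ 2 ^ j := by
    intro heq
    have h1 : 2 * r + 1 = 1 := by
      refine Nat.eq_of_mul_eq_mul_left (show 0 < 2 ^ j by positivity) ?_
      rw [← hk, heq, mul_one]
    have h2 : 0 < 2 ^ d := by positivity
    omega
  have hlist : E.releaseList k = some l := by
    rw [releaseList, hexp, if_neg hnpow, hlog]
    simpa [j] using hl
  have hrel : ∃ t, E.released E.releaseList k t = true := E.exists_released_iff.2 fun l' hl' => by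
    rw [hlist, Option.some_inj] at hl'
    rwa [← hl']
  obtain ⟨t, ht, hmin⟩ := E.exists_first_released hrel
  -- The list is still untouched at stage `h s`, so the release comes later, when the program has
  -- already answered on `2 * k < 2^(s+2)`.
  have hht : h (j + 1 + d) ≤ t := by
    by_contra hcon
    obtain ⟨x, hx, hxs⟩ := E.released_iff.1 (E.released_mono (not_le.1 hcon).le ht) l hlist
    simp [hlate x hx] at hxs
  have hhalf : 2 * k / 2 = k := by omega
  have hmem := E.mem_releaseSet_iff (V := diagonalValue) (x := 2 * k)
    (by rwa [hhalf]) (by rwa [hhalf])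
  have hval : code.evaln t (2 * k) = some (bif decide (2 * k ∈ D) then 1 else 0) := by
    obtain ⟨y, hy⟩ := Option.isSome_iff_exists.1
      (hconv (j + 1 + d) (2 * k) (by rw [pow_succ] at hlt ⊢; omega))
    have hy1 := Code.evaln_sound hy
    rw [heval, Part.mem_some_iff] at hy1
    rw [← hy1]
    exact Code.evaln_mono hht hy
  have hdiag : diagonalValue k t = !decide (2 * k ∈ D) := by
    rw [diagonalValue, hexp, decide_eq_false hnpow, Bool.false_or]
    simp only [j, Nat.unpair_pair, ofNat_encode, hval]
    cases decide (2 * k ∈ D) <;> simp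
  rw [Set.mem_ofPred_eq, hmem, hhalf, hdiag] at hagree
  by_cases hkD : 2 * k ∈ D <;> simp [hkD] at hagree

end StageEnumeration

/-- Every nonlow c.e. Turing degree contains a c.e. set of asymptotic density `1 / 2` that is not
coarsely computable. -/
theorem theorem4p2 (a : TuringDegree) (hce : IsCEDegree a) (hlow : ¬ IsLowDegree a) :
    ∃ A : Set ℕ, turingDegreeOf A = a ∧ IsCESet A ∧ HasAsymptoticDensity A (1 / 2) ∧
      ¬ IsCoarselyComputable A := by
  obtain ⟨C, rfl, hC⟩ := hce
  obtain ⟨E⟩ := hC.exists_stageEnumeration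
  exact ⟨_, E.turingDegreeOf_releaseSet,
    E.isCESet_releaseSet E.primrec_releaseList primrec_diagonalValue,
    E.hasAsymptoticDensity_releaseSet E.finite_never_released,
    E.not_isCoarselyComputable_releaseSet fun h => hlow ⟨C, rfl, h⟩⟩
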